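/- Let $M$ be a smooth manifold (finite-dimensional, without boundary, Hausdorff, $\sigma$-compact), and let $\mathbf TM=TM\oplus T^*M$ carry the neutral metric $g((X,\alpha),(Y,\mu))=\alpha(Y)+\mu(X)$ and the Courant bracket $$[(X,\alpha),(Y,\mu)]=\bigl([X,Y],\,L_X\mu-L_Y\alpha+\tfrac12 d(\alpha(Y)-\mu(X))\bigr).$$ Let $\tau$ be a generalized 2-nilpotent structure on $M$, that is, a smooth endomorphism $\tau$ of $\mathbf TM$ of constant rank with $\tau^2=0$ and $g(\mathcal X,\tau\mathcal Y)+g(\tau\mathcal X,\mathcal Y)=0$. Put $E=\operatorname{im}\tau$, and let $E^{\perp_g}$ be its $g$-orthogonal bundle; it equals $\ker\tau$. Put $\tilde E=\mathbf TM/E^{\perp_g}$, and let $\tau':\tilde E\to E$ be the isomorphism induced by $\tau$. The structure $\tau$ is *integrable* if $$\mathcal N_\tau(\mathcal X,\mathcal Y)=[\tau\mathcal X,\tau\mathcal Y]-\tau[\mathcal X,\tau\mathcal Y]-\tau[\tau\mathcal X,\mathcal Y]+\tau^2[\mathcal X,\mathcal Y]$$ vanishes for all $\mathcal X,\mathcal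 Y\in\Gamma\mathbf TM$, and *weakly integrable* if $\Gamma E$ is closed under the Courant bracket. Put $[\mathcal X,\mathcal Y]_\tau=[\tau\mathcal X,\mathcal Y]+[\mathcal X,\tau\mathcal Y]$. 1. If $\tau$ is weakly integrable, then $[\mathcal X_{\mathrm{mod}\,E^{\perp_g}},\mathcal Y_{\mathrm{mod}\,E^{\perp_g}}]_\tau=([\mathcal X,\mathcal Y]_\tau)_{\mathrm{mod}\,E^{\perp_g}}$ is a well-defined bracket on $\Gamma\tilde E$, the *induced $\tau$-bracket*. 2. If $\tau$ is integrable, then $\tau$ is weakly integrable; $\tilde E$ with the induced $\tau$-bracket and the anchor $pr_{TM}\circ\tau'$ is a Lie algebroid; $E$ with the Courant bracket and the anchor $pr_{TM}|_E$ is a Lie algebroid; and $\tau':\tilde E\to E$ is an isomorphism of Lie algebroids. 3. If $\tau$ is weakly integrable, then $\tau$ is integrable if and only if the induced $\tau$-bracket is equal to the bracket $[s,t]_{\tilde E}=\tau'^{-1}[\tau's,\tau't]$ on $\Gamma\tilde E$. -/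

import Mathlib

open scoped Bundle Manifold ContDiff Topology

namespace BigTangent

noncomputable section

section BigTangentBundle

variable {E : Type*} [NormedAddCommGroup E] [NormedSpace ℝ E]
  {H : Type*} [TopologicalSpace H]

/-- The cotangent space `T*ₓM`; by Mathlib's instances it is the fibre of a smooth bundle. -/
abbrev CotangentSpace (I : ModelWithCorners ℝ E H) {M : Type*} [TopologicalSpace M]
    [ChartedSpace H M] (x : M) : Type _ :=
  TangentSpace I x →L[ℝ] ℝ

/-- The fibre at `x` of the big tangent bundle `𝐓M = TM ⊕ T*M`. The bundle structure is Mathlib's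
direct sum of vector bundles. -/
abbrev BigTangentSpace (I : ModelWithCorners ℝ E H) {M : Type*} [TopologicalSpace M]
    [ChartedSpace H M] (x : M) : Type _ :=
  TangentSpace I x × CotangentSpace I x

/-- The model fibre of the big tangent bundle. -/
abbrev BigModel (E : Type*) [NormedAddCommGroup E] [NormedSpace ℝ E] : Type _ :=
  E × (E →L[ℝ] ℝ)

/-- The total space of the big tangent bundle. -/
abbrev BigTotalSpace (I : ModelWithCorners ℝ E H) (M : Type*) [TopologicalSpace M]
    [ChartedSpace H M] : Type _ :=
  Bundle.TotalSpace (BigModel E) (fun x : M ↦ BigTangentSpace I x)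

/-- The neutral metric `g((X, α), (Y, μ)) = α(Y) + μ(X)` on the fibre at `x`. -/
def neutralMetric (I : ModelWithCorners ℝ E H) {M : Type*} [TopologicalSpace M]
    [ChartedSpace H M] (x : M) : LinearMap.BilinForm ℝ (BigTangentSpace I x) :=
  LinearMap.mk₂ ℝ (fun v w ↦ v.2 w.1 + w.2 v.1)
    (by intro v v' w; simp; ring) (by intro c v w; simp; ring)
    (by intro v w w'; simp; ring) (by intro c v w; simp; ring)

variable (I : ModelWithCorners ℝ E H) (M : Type*) [TopologicalSpace M] [ChartedSpace H M]
  [IsManifold I ∞ M]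

/-- Smooth vector fields. -/
abbrev VectorFields : Type _ := Cₛ^∞⟮I; E, fun x : M ↦ TangentSpace I x⟯

/-- Smooth differential `1`-forms. -/
abbrev OneForms : Type _ := Cₛ^∞⟮I; E →L[ℝ] ℝ, fun x : M ↦ CotangentSpace I x⟯

/-- `Γ 𝐓M`: smooth sections of the big tangent bundle. -/
abbrev BigSections : Type _ := Cₛ^∞⟮I; BigModel E, fun x : M ↦ BigTangentSpace I x⟯

variable {I M}

/-- The vector field `X` of a section `(X, α)` of the big tangent bundle. -/
def BigSections.vec (X : BigSections I M) : VectorFields I M where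
  toFun x := (X x).1
  contMDiff_toFun := by
    intro x
    have h := X.contMDiff x
    rw [Bundle.contMDiffAt_section] at h ⊢
    exact (contDiff_fst.contMDiff (f := (Prod.fst : BigModel E → E))).contMDiffAt.comp x h

/-- The `1`-form `α` of a section `(X, α)` of the big tangent bundle. -/
def BigSections.form (X : BigSections I M) : OneForms I M where
  toFun x := (X x).2
  contMDiff_toFun := by
    intro x
    have h := X.contMDiff x
    rw [Bundle.contMDiffAt_section] at h ⊢
    exact (contDiff_snd.contMDiff (f := (Prod.snd : BigModel E → _))).contMDiffAt.comp x h

/-! ### The Lie derivative of a 1-form and the Courant bracket -/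

/-- The expression `X(μ(Z)) - μ([X, Z])` at the point `x`, as a function of the vector field `Z`. -/
def lieDerivativeOn (X : Π x : M, TangentSpace I x) (μ : Π x : M, CotangentSpace I x) (x : M)
    (Z : Π x : M, TangentSpace I x) : ℝ :=
  mvfderiv I (fun y ↦ μ y (Z y)) x (X x) - μ x (VectorField.mlieBracket I X Z x)

variable [FiniteDimensional ℝ E]

theorem tensorialAt_lieDerivativeOn (X : VectorFields I M) (μ : OneForms I M) (x : M) :
    TensorialAt I E (lieDerivativeOn (I := I) X μ x) x := by
  have : CompleteSpace E := FiniteDimensional.complete ℝ E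
  have key : ∀ {Z : Π x : M, TangentSpace I x}, MDiffAt (T% Z) x →
      MDiffAt (fun y ↦ μ y (Z y)) x := by
    intro Z hZ
    have h1 := (μ.contMDiff x).mdifferentiableAt (by simp)
    have h2 := MDifferentiableAt.clm_bundle_apply (F₂ := ℝ) (E₂ := fun _ : M ↦ ℝ) h1 hZ
    exact (mdifferentiableAt_section (F := ℝ) I _).1 h2
  constructor
  · intro f Z hf hZ
    have h1 : (fun y ↦ μ y ((f • Z) y)) = f • fun y ↦ μ y (Z y) := by
      ext y; simp
    unfold lieDerivativeOn
    rw [VectorField.mlieBracket_smul_right hf hZ, h1, mvfderiv_smul hf (key hZ)]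
    simp
    ring
  · intro Z Z' hZ hZ'
    have h1 : (fun y ↦ μ y ((Z + Z') y)) = (fun y ↦ μ y (Z y)) + fun y ↦ μ y (Z' y) := by
      ext y; simp
    unfold lieDerivativeOn
    rw [VectorField.mlieBracket_add_right hZ hZ', h1, mvfderiv_add (key hZ) (key hZ')]
    simp
    ring

/-- The Lie derivative `L_X μ` of a `1`-form: the covector at `x` characterized by
`(L_X μ)(Z) = X(μ(Z)) - μ([X, Z])` for all vector fields `Z`. -/
def lieDerivative (X : VectorFields I M) (μ : OneForms I M) (x : M) : CotangentSpace I x :=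
  TensorialAt.mkHom (lieDerivativeOn (I := I) X μ x) x (tensorialAt_lieDerivativeOn X μ x)

theorem lieDerivative_apply (X : VectorFields I M) (μ : OneForms I M) (x : M)
    (Z : VectorFields I M) :
    lieDerivative X μ x (Z x) =
      mvfderiv I (fun y ↦ μ y (Z y)) x (X x) - μ x (VectorField.mlieBracket I X Z x) :=
  TensorialAt.mkHom_apply (tensorialAt_lieDerivativeOn X μ x)
    ((Z.contMDiff x).mdifferentiableAt (by simp))

/-- The Courant bracket
`[(X, α), (Y, μ)] = ([X, Y], L_X μ - L_Y α + (1/2) d(α(Y) - μ(X)))`. -/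
def courantBracket (X Y : BigSections I M) (x : M) : BigTangentSpace I x :=
  (VectorField.mlieBracket I X.vec Y.vec x,
    lieDerivative X.vec Y.form x - lieDerivative Y.vec X.form x
      + (1 / 2 : ℝ) • mvfderiv I (fun y ↦ X.form y (Y.vec y) - Y.form y (X.vec y)) x)

end BigTangentBundle

/-! ### Vector bundles through their smooth sections, and Lie algebroids -/

section LieAlgebroids

variable {E : Type*} [NormedAddCommGroup E] [NormedSpace ℝ E]
  {H : Type*} [TopologicalSpace H] (I : ModelWithCorners ℝ E H)
  {M : Type*} [TopologicalSpace M] [ChartedSpace H M] [IsManifold I ∞ M]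
  {V : M → Type*} [∀ x, AddCommGroup (V x)] [∀ x, Module ℝ (V x)]
  {V' : M → Type*} [∀ x, AddCommGroup (V' x)] [∀ x, Module ℝ (V' x)]

/-- The family of vector spaces `V x`, `x ∈ M`, is a smooth vector bundle (of constant finite rank)
with `Γ` as its space of smooth sections: `Γ` is a `C^∞(M)`-module, being in `Γ` is a local
condition, and near every point there is a frame of elements of `Γ` in which the elements of `Γ`
have smooth coefficients. -/
structure IsSmoothVectorBundle (Γ : Submodule ℝ (Π x : M, V x)) : Prop where
  smul_mem : ∀ (f : C^∞⟮I, M; ℝ⟯) (s : Π x : M, V x), s ∈ Γ → (fun x ↦ f x • s x) ∈ Γ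
  mem_of_locally : ∀ s : Π x : M, V x,
    (∀ x₀ : M, ∃ t ∈ Γ, ∀ᶠ x in 𝓝 x₀, s x = t x) → s ∈ Γ
  exists_frame : ∃ k : ℕ, ∀ x₀ : M, ∃ e : Fin k → Π x : M, V x,
    (∀ i, e i ∈ Γ) ∧
    (∀ᶠ x in 𝓝 x₀, LinearIndependent ℝ (fun i ↦ e i x) ∧
      Submodule.span ℝ (Set.range fun i ↦ e i x) = ⊤) ∧
    ∀ s ∈ Γ, ∃ f : Fin k → C^∞⟮I, M; ℝ⟯, ∀ᶠ x in 𝓝 x₀, s x = ∑ i, f i x • e i x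

/-- The bundle `V` with smooth sections `Γ`, the bracket `br` on `Γ` and the anchor
`ρ : V → TM` is a Lie algebroid over `M`. -/
structure IsLieAlgebroid (Γ : Submodule ℝ (Π x : M, V x)) (br : Γ → Γ → Π x : M, V x)
    (ρ : Π x : M, V x →ₗ[ℝ] TangentSpace I x) : Prop where
  isSmoothVectorBundle : IsSmoothVectorBundle I Γ
  anchor_smooth : ∀ s : Γ, ContMDiff I (I.prod 𝓘(ℝ, E)) ∞
    (fun x ↦ Bundle.TotalSpace.mk' E (E := fun x : M ↦ TangentSpace I x) x (ρ x (s.1 x)))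
  bracket_mem : ∀ s t : Γ, br s t ∈ Γ
  bracket_add : ∀ s t u : Γ, br s (t + u) = br s t + br s u
  bracket_smul : ∀ (c : ℝ) (s t : Γ), br s (c • t) = c • br s t
  bracket_skew : ∀ s t : Γ, br s t = -br t s
  jacobi : ∀ s t u : Γ,
    br s ⟨br t u, bracket_mem t u⟩ + br t ⟨br u s, bracket_mem u s⟩
      + br u ⟨br s t, bracket_mem s t⟩ = 0
  leibniz : ∀ (s t : Γ) (f : C^∞⟮I, M; ℝ⟯) (x : M),
    br s ⟨fun y ↦ f y • t.1 y, isSmoothVectorBundle.smul_mem f t.1 t.2⟩ x =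
      f x • br s t x + mvfderiv I f x (ρ x (s.1 x)) • t.1 x
  anchor_bracket : ∀ (s t : Γ) (x : M),
    ρ x (br s t x) =
      VectorField.mlieBracket I (fun y ↦ ρ y (s.1 y)) (fun y ↦ ρ y (t.1 y)) x

/-- The fibrewise linear isomorphisms `φ x : V x ≃ V' x` form an isomorphism of vector bundles (they
identify the smooth sections) that intertwines the anchors and the brackets. -/
structure IsLieAlgebroidIso (Γ : Submodule ℝ (Π x : M, V x)) (br : Γ → Γ → Π x : M, V x)
    (ρ : Π x : M, V x →ₗ[ℝ] TangentSpace I x)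
    (Γ' : Submodule ℝ (Π x : M, V' x)) (br' : Γ' → Γ' → Π x : M, V' x)
    (ρ' : Π x : M, V' x →ₗ[ℝ] TangentSpace I x) (φ : Π x : M, V x ≃ₗ[ℝ] V' x) : Prop where
  mem_iff : ∀ s : Π x : M, V x, s ∈ Γ ↔ (fun x ↦ φ x (s x)) ∈ Γ'
  map_anchor : ∀ (x : M) (v : V x), ρ' x (φ x v) = ρ x v
  map_bracket : ∀ (s t : Γ) (x : M),
    φ x (br s t x) = br' ⟨fun y ↦ φ y (s.1 y), (mem_iff s.1).1 s.2⟩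
      ⟨fun y ↦ φ y (t.1 y), (mem_iff t.1).1 t.2⟩ x

end LieAlgebroids

/-! ### Generalized 2-nilpotent structures -/

section TwoNilpotent

variable {E : Type*} [NormedAddCommGroup E] [NormedSpace ℝ E]
  {H : Type*} [TopologicalSpace H]

/-- A generalized 2-nilpotent structure: a smooth endomorphism `τ` of the big tangent bundle, of
constant rank, `g`-skew-symmetric and with `τ² = 0`. -/
structure TwoNilpotentStructure (I : ModelWithCorners ℝ E H) (M : Type*) [TopologicalSpace M]
    [ChartedSpace H M] [IsManifold I ∞ M] where
  toFun : Π x : M, BigTangentSpace I x →ₗ[ℝ] BigTangentSpace I x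
  contMDiff_toFun : ContMDiff (I.prod 𝓘(ℝ, BigModel E)) (I.prod 𝓘(ℝ, BigModel E)) ∞
    (fun p : BigTotalSpace I M ↦ (⟨p.1, toFun p.1 p.2⟩ : BigTotalSpace I M))
  sq_zero : ∀ (x : M) (v : BigTangentSpace I x), toFun x (toFun x v) = 0
  skew : ∀ (x : M) (v w : BigTangentSpace I x),
    neutralMetric I x v (toFun x w) + neutralMetric I x (toFun x v) w = 0
  const_rank : ∃ r : ℕ, ∀ x : M, Module.finrank ℝ (LinearMap.range (toFun x)) = r

variable {I : ModelWithCorners ℝ E H} {M : Type*} [TopologicalSpace M] [ChartedSpace H M]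
  [IsManifold I ∞ M]

namespace TwoNilpotentStructure

variable (τ : TwoNilpotentStructure I M)

/-- The section `τ 𝒳` of the big tangent bundle. -/
def apply (X : BigSections I M) : BigSections I M where
  toFun x := τ.toFun x (X x)
  contMDiff_toFun := τ.contMDiff_toFun.comp X.contMDiff

/-- The fibre `Eₓ ⊆ 𝐓ₓM` of `E = im τ`, as a subspace. -/
abbrev image (x : M) : Submodule ℝ (BigTangentSpace I x) := LinearMap.range (τ.toFun x)

/-- The fibre `Eₓ` of `E = im τ`, as a vector space. -/
def Image (x : M) : Type _ := τ.image x

instance (x : M) : AddCommGroup (τ.Image x) := inferInstanceAs (AddCommGroup (τ.image x))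

instance (x : M) : Module ℝ (τ.Image x) := inferInstanceAs (Module ℝ (τ.image x))

/-- The inclusion of `Eₓ` in `𝐓ₓM`. -/
def incl (x : M) : τ.Image x →ₗ[ℝ] BigTangentSpace I x := (τ.image x).subtype

/-- The fibre at `x` of the `g`-orthogonal bundle of `E`. -/
def perp (x : M) : Submodule ℝ (BigTangentSpace I x) :=
  (neutralMetric I x).orthogonal (τ.image x)

/-- The fibre at `x` of `Ẽ = 𝐓M / E^⊥`. -/
def Quot (x : M) : Type _ := BigTangentSpace I x ⧸ τ.perp x

instance (x : M) : AddCommGroup (τ.Quot x) :=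
  inferInstanceAs (AddCommGroup (BigTangentSpace I x ⧸ τ.perp x))

instance (x : M) : Module ℝ (τ.Quot x) :=
  inferInstanceAs (Module ℝ (BigTangentSpace I x ⧸ τ.perp x))

/-- The projection `v ↦ v mod Eₓ^⊥` of `𝐓ₓM` on `Ẽₓ`. -/
def proj (x : M) : BigTangentSpace I x →ₗ[ℝ] τ.Quot x := (τ.perp x).mkQ

/-- `Γ E`: the sections of `E` which are smooth as sections of the big tangent bundle. -/
def imageSections : Submodule ℝ (Π x : M, τ.Image x) where
  carrier := {s | ContMDiff I (I.prod 𝓘(ℝ, BigModel E)) ∞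
    (fun x ↦ (⟨x, τ.incl x (s x)⟩ : BigTotalSpace I M))}
  add_mem' hs ht := ContMDiff.add_section hs ht
  zero_mem' := Bundle.contMDiff_zeroSection ℝ (fun x : M ↦ BigTangentSpace I x)
  smul_mem' _ _ hs := ContMDiff.const_smul_section hs

/-- A section of `E` seen as a section of the big tangent bundle. -/
def ofImage (s : τ.imageSections) : BigSections I M := ⟨fun x ↦ τ.incl x (s.1 x), s.2⟩

/-- `Γ Ẽ`: the sections of `Ẽ` which near every point are the class of a smooth section of the
big tangent bundle. -/
def quotSections : Submodule ℝ (Π x : M, τ.Quot x) where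
  carrier := {s | ∀ x₀ : M, ∃ X : BigSections I M,
    ∀ᶠ x in 𝓝 x₀, s x = τ.proj x (X x)}
  add_mem' := by
    intro s t hs ht x₀
    obtain ⟨X, hX⟩ := hs x₀
    obtain ⟨Y, hY⟩ := ht x₀
    refine ⟨X + Y, ?_⟩
    filter_upwards [hX, hY] with x h1 h2
    simp [h1, h2]
  zero_mem' := fun x₀ ↦ ⟨0, Filter.Eventually.of_forall fun x ↦ by simp⟩
  smul_mem' := by
    intro c s hs x₀
    obtain ⟨X, hX⟩ := hs x₀
    refine ⟨c • X, ?_⟩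
    filter_upwards [hX] with x h1
    simp [h1]

/-- The section `𝒳 mod E^⊥` of `Ẽ`. -/
def mkQuot (X : BigSections I M) : τ.quotSections :=
  ⟨fun x ↦ τ.proj x (X x), fun _ ↦ ⟨X, Filter.Eventually.of_forall fun _ ↦ rfl⟩⟩

theorem mem_perp_iff (x : M) (v : BigTangentSpace I x) :
    v ∈ τ.perp x ↔ ∀ w, neutralMetric I x (τ.toFun x w) v = 0 := by
  refine ⟨fun h w ↦ h _ ⟨w, rfl⟩, ?_⟩
  rintro h _ ⟨w, rfl⟩
  exact h w

theorem perp_eq_ker (x : M) : τ.perp x = LinearMap.ker (τ.toFun x) := by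
  ext v
  rw [mem_perp_iff, LinearMap.mem_ker]
  have h : ∀ w, neutralMetric I x (τ.toFun x w) v = - neutralMetric I x w (τ.toFun x v) := by
    intro w
    linarith [τ.skew x w v]
  constructor
  · intro hv
    have h0 : ∀ w, neutralMetric I x w (τ.toFun x v) = 0 := by
      intro w
      have h1 := h w
      rw [hv w] at h1
      linarith
    refine Prod.ext ?_ ?_
    · by_contra hne
      obtain ⟨f, hf⟩ := SeparatingDual.exists_ne_zero (R := ℝ) (V := E) hne
      have h1 : f (τ.toFun x v).1 + (τ.toFun x v).2 0 = 0 := h0 (0, f)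
      rw [map_zero, add_zero] at h1
      exact hf h1
    · ext z
      simpa [neutralMetric] using h0 (z, 0)
  · intro hv w
    rw [h w, hv]
    simp

/-- The isomorphism `τ' : Ẽ → E` induced by `τ`. -/
def tauPrime (x : M) : τ.Quot x ≃ₗ[ℝ] τ.Image x :=
  (Submodule.quotEquivOfEq _ _ (τ.perp_eq_ker x)).trans (τ.toFun x).quotKerEquivRange

theorem tauPrime_mk (x : M) (v : BigTangentSpace I x) :
    τ.incl x (τ.tauPrime x (τ.proj x v)) = τ.toFun x v := rfl

/-- The section `τ' s` of `E`, for a section `s` of `Ẽ`. -/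
def tauPrimeSection (s : τ.quotSections) : τ.imageSections :=
  ⟨fun x ↦ τ.tauPrime x (s.1 x), by
    intro x₀
    obtain ⟨X, hX⟩ := s.2 x₀
    refine ((τ.apply X).contMDiff x₀).congr_of_eventuallyEq ?_
    filter_upwards [hX] with x hx
    rw [hx]
    rfl⟩

variable [FiniteDimensional ℝ E]

/-- `τ` is weakly integrable: `E = im τ` is closed under the Courant bracket. -/
def IsWeaklyIntegrable : Prop :=
  ∀ (s t : τ.imageSections) (x : M), courantBracket (τ.ofImage s) (τ.ofImage t) x ∈ τ.image x

/-- The Courant-Nijenhuis torsion of `τ`. -/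
def courantNijenhuis (X Y : BigSections I M) (x : M) : BigTangentSpace I x :=
  courantBracket (τ.apply X) (τ.apply Y) x - τ.toFun x (courantBracket X (τ.apply Y) x)
    - τ.toFun x (courantBracket (τ.apply X) Y x) + τ.toFun x (τ.toFun x (courantBracket X Y x))

/-- `τ` is integrable: its Courant-Nijenhuis torsion vanishes. -/
def IsIntegrable : Prop := ∀ (X Y : BigSections I M) (x : M), τ.courantNijenhuis X Y x = 0

/-- The Courant bracket on `Γ E`. -/
def imageBracket (hτ : τ.IsWeaklyIntegrable) (s t : τ.imageSections) (x : M) : τ.Image x :=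
  ⟨courantBracket (τ.ofImage s) (τ.ofImage t) x, hτ s t x⟩

/-- The anchor of `E`, the restriction of the projection of the big tangent bundle on `TM`. -/
def imageAnchor (x : M) : τ.Image x →ₗ[ℝ] TangentSpace I x :=
  (LinearMap.fst ℝ (TangentSpace I x) (CotangentSpace I x)).comp (τ.incl x)

/-- The bracket `[s, t]_Ẽ = τ'⁻¹ [τ' s, τ' t]` on `Γ Ẽ`. -/
def quotBracket (hτ : τ.IsWeaklyIntegrable) (s t : τ.quotSections) (x : M) : τ.Quot x :=
  (τ.tauPrime x).symm (τ.imageBracket hτ (τ.tauPrimeSection s) (τ.tauPrimeSection t) x)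

/-- The anchor `pr_TM ∘ τ'` of `Ẽ`. -/
def quotAnchor (x : M) : τ.Quot x →ₗ[ℝ] TangentSpace I x :=
  (τ.imageAnchor x).comp (τ.tauPrime x).toLinearMap

/-- The bracket `[𝒳, 𝒴]_τ = [τ 𝒳, 𝒴] + [𝒳, τ 𝒴]` on `Γ 𝐓M`. -/
def tauBracket (X Y : BigSections I M) (x : M) : BigTangentSpace I x :=
  courantBracket (τ.apply X) Y x + courantBracket X (τ.apply Y) x

theorem exists_mkQuot_eq [T2Space M] [SigmaCompactSpace M] (s : τ.quotSections) :
    ∃ X : BigSections I M, τ.mkQuot X = s := by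
  obtain ⟨X, hX⟩ := exists_contMDiffSection_forall_mem_convex_of_local I (n := ⊤)
    (F_fiber := BigModel E)
    (fun x : M ↦ BigTangentSpace I x) (fun x ↦ {v | τ.proj x v = s.1 x})
    (by
      intro x v hv w hw a b _ _ hab
      change τ.proj x _ = _ at hv hw ⊢
      rw [map_add, map_smul, map_smul, hv, hw, ← add_smul, hab, one_smul])
    (by
      intro x₀
      obtain ⟨X, hX⟩ := s.2 x₀
      exact ⟨_, hX, X, X.contMDiff.contMDiffOn, fun y hy ↦ hy.symm⟩)
  exact ⟨X, Subtype.ext (funext hX)⟩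

/-- The induced `τ`-bracket on `Γ Ẽ`: the class of `[𝒳, 𝒴]_τ`, where `𝒳` and `𝒴` represent the two
sections. (For a weakly integrable `τ` it does not depend on the choice.) -/
def inducedBracket [T2Space M] [SigmaCompactSpace M] (s t : τ.quotSections) (x : M) : τ.Quot x :=
  τ.proj x
    (τ.tauBracket (τ.exists_mkQuot_eq s).choose (τ.exists_mkQuot_eq t).choose x)

end TwoNilpotentStructure

end TwoNilpotent

end

end BigTangent

namespace BigTangent

noncomputable section

section Analysis

variable {E : Type*} [NormedAddCommGroup E] [NormedSpace ℝ E]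
  {H : Type*} [TopologicalSpace H] {I : ModelWithCorners ℝ E H}
  {M : Type*} [TopologicalSpace M] [ChartedSpace H M]

open VectorField Set

/-- The derivative of `f` along `X`, read in the chart at `x`. -/
theorem mvfderiv_chart [IsManifold I 1 M] {f : M → ℝ} (x : M) {z : E}
    (hz : z ∈ (extChartAt I x).target) (hf : MDifferentiableAt I 𝓘(ℝ, ℝ) f ((extChartAt I x).symm z))
    (X : Π x : M, TangentSpace I x) :
    mvfderiv I f ((extChartAt I x).symm z) (X ((extChartAt I x).symm z)) =
      fderivWithin ℝ (f ∘ (extChartAt I x).symm) (range I) z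
        (mpullbackWithin 𝓘(ℝ, E) I (extChartAt I x).symm X (range I) z) := by
  have hinv := isInvertible_mfderivWithin_extChartAt_symm hz
  have h1 : mfderivWithin 𝓘(ℝ, E) 𝓘(ℝ, ℝ) (f ∘ (extChartAt I x).symm) (range I) z =
      (mfderiv I 𝓘(ℝ, ℝ) f ((extChartAt I x).symm z)) ∘L
        (mfderivWithin 𝓘(ℝ, E) I (extChartAt I x).symm (range I) z) :=
    mfderiv_comp_mfderivWithin z hf (mdifferentiableWithinAt_extChartAt_symm hz)
      (I.uniqueMDiffOn _ (extChartAt_target_subset_range x hz))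
  rw [mfderivWithin_eq_fderivWithin] at h1
  rw [h1, mpullbackWithin_apply]
  have h2 : ∀ v, (mfderivWithin 𝓘(ℝ, E) I (extChartAt I x).symm (range I) z)
      ((mfderivWithin 𝓘(ℝ, E) I (extChartAt I x).symm (range I) z).inverse v) = v := by
    intro v
    exact hinv.self_apply_inverse v
  exact congrArg (mfderiv I 𝓘(ℝ, ℝ) f ((extChartAt I x).symm z)) (h2 _).symm

theorem inverse_mfderiv_extChartAt_self_apply [IsManifold I 1 M] (x : M) (v : TangentSpace I x) :
    (mfderiv I 𝓘(ℝ, E) (extChartAt I x) x).inverse v = v := by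
  rw [mfderiv_extChartAt_self]
  exact congrArg (fun L : E →L[ℝ] E ↦ L v) (ContinuousLinearMap.inverse_id (R := ℝ) (M := E))

/-- `[X, Y] f = X (Y f) - Y (X f)`. -/
theorem mvfderiv_mlieBracket [IsManifold I ∞ M] [CompleteSpace E]
    {X Y : Π x : M, TangentSpace I x} {f : M → ℝ} {x : M}
    (hX : MDiffAt (T% X) x) (hY : MDiffAt (T% Y) x) (hf : CMDiff ∞ f)
    (hXf : MDiffAt (fun y ↦ mvfderiv I f y (X y)) x)
    (hYf : MDiffAt (fun y ↦ mvfderiv I f y (Y y)) x) :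
    mvfderiv I f x (mlieBracket I X Y x) =
      mvfderiv I (fun y ↦ mvfderiv I f y (Y y)) x (X x) -
        mvfderiv I (fun y ↦ mvfderiv I f y (X y)) x (Y x) := by
  have hI : IsManifold I 1 M := .of_le (n := ∞) (by simp)
  set φ := extChartAt I x with hφ
  set z := φ x with hz
  have hzt : z ∈ φ.target := mem_extChartAt_target x
  have hsymm : φ.symm z = x := extChartAt_to_inv x
  have hfd : ∀ y, MDiffAt f y := fun y ↦ (hf y).mdifferentiableAt (by simp)
  have key : ∀ (g : M → ℝ) (Z : Π x : M, TangentSpace I x), MDiffAt g x →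
      mvfderiv I g x (Z x) = fderivWithin ℝ (g ∘ φ.symm) (range I) z
        (mpullbackWithin 𝓘(ℝ, E) I φ.symm Z (range I) z) := by
    intro g Z hg
    have := mvfderiv_chart x hzt (by rwa [← hφ, hsymm]) Z (f := g)
    rw [← this, ← hφ, hsymm]
  have hb : mpullbackWithin 𝓘(ℝ, E) I φ.symm (mlieBracket I X Y) (range I) z =
      lieBracketWithin ℝ (mpullbackWithin 𝓘(ℝ, E) I φ.symm X (range I))
        (mpullbackWithin 𝓘(ℝ, E) I φ.symm Y (range I)) (range I) z := by
    have h1 : (mpullbackWithin 𝓘(ℝ, E) I φ.symm (mlieBracket I X Y) (range I) z : E) =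
        mlieBracket I X Y (φ.symm z) :=
      mfderivWithin_extChartAt_symm_inverse_apply (I := I) (x := x) _
    have h2 : (mlieBracket I X Y (φ.symm z) : E) = mlieBracket I X Y x :=
      congrArg (fun y ↦ (mlieBracket I X Y y : E)) hsymm
    refine h1.trans (h2.trans ?_)
    rw [mlieBracket, mlieBracketWithin_apply, preimage_univ, univ_inter]
    exact inverse_mfderiv_extChartAt_self_apply x _
  have hev : ∀ Z : Π x : M, TangentSpace I x,
      ((fun y ↦ mvfderiv I f y (Z y)) ∘ φ.symm) =ᶠ[𝓝[range I] z]
      (fun w ↦ fderivWithin ℝ (f ∘ φ.symm) (range I) w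
        (mpullbackWithin 𝓘(ℝ, E) I φ.symm Z (range I) w)) := by
    intro Z
    filter_upwards [extChartAt_target_mem_nhdsWithin x] with w hw
    exact mvfderiv_chart x hw (hfd _) Z
  have hdiff : ∀ Z : Π x : M, TangentSpace I x, MDiffAt (T% Z) x →
      DifferentiableWithinAt ℝ (mpullbackWithin 𝓘(ℝ, E) I φ.symm Z (range I)) (range I) z := by
    intro Z hZ
    have := MDifferentiableWithinAt.differentiableWithinAt_mpullbackWithin_vectorField
      (hZ.mdifferentiableWithinAt (s := univ))
    rwa [preimage_univ, univ_inter] at this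
  have hfc : ContDiffWithinAt ℝ ∞ (f ∘ φ.symm) (range I) z := by
    exact (contMDiffAt_iff.1 (hf x)).2
  rw [key f _ (hfd x), hb, key _ X hYf, key _ Y hXf,
    (hev X).fderivWithin_eq ((hev X).self_of_nhdsWithin (extChartAt_target_subset_range x hzt)),
    (hev Y).fderivWithin_eq ((hev Y).self_of_nhdsWithin (extChartAt_target_subset_range x hzt))]
  exact fderivWithin_apply_lieBracket hfc (by simpa using ENat.LEInfty.out) I.uniqueDiffOn
    (I.range_subset_closure_interior (extChartAt_target_subset_range x hzt))
    (extChartAt_target_subset_range x hzt) (hdiff Y hY) (hdiff X hX)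

theorem contMDiff_mvfderiv [IsManifold I ∞ M] {f : M → ℝ} (hf : CMDiff ∞ f)
    {X : Π x : M, TangentSpace I x} (hX : CMDiff ∞ (T% X)) :
    CMDiff ∞ (fun x ↦ mvfderiv I f x (X x)) := by
  have h := (hf.contMDiff_tangentMap (m := ∞) (by simp)).comp hX
  exact (contMDiff_snd_tangentBundle_modelSpace ℝ 𝓘(ℝ, ℝ)).comp h

end Analysis

section Extension

variable {E : Type*} [NormedAddCommGroup E] [NormedSpace ℝ E] [FiniteDimensional ℝ E]
  {H : Type*} [TopologicalSpace H] {I : ModelWithCorners ℝ E H}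
  {M : Type*} [TopologicalSpace M] [ChartedSpace H M] [IsManifold I ∞ M]
  [T2Space M] [SigmaCompactSpace M]

section Sections

variable {F : Type*} [NormedAddCommGroup F] [NormedSpace ℝ F]
  {V : M → Type*} [∀ x, AddCommGroup (V x)] [∀ x, Module ℝ (V x)] [∀ x, TopologicalSpace (V x)]
  [TopologicalSpace (Bundle.TotalSpace F V)] [FiberBundle F V] [VectorBundle ℝ F V]

theorem exists_contMDiffSection_eventuallyEq {x₀ : M} {U : Set M} (hU : U ∈ 𝓝 x₀)
    {s : Π x : M, V x} (hs : CMDiff[U] ∞ (T% s)) :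
    ∃ Z : Cₛ^∞⟮I; F, V⟯, ∀ᶠ x in 𝓝 x₀, Z x = s x := by
  classical
  have : LocallyCompactSpace M := Manifold.locallyCompact_of_finiteDimensional I
  obtain ⟨C, ⟨hC, hCc⟩, hCU⟩ := (closed_nhds_basis x₀).mem_iff.1 (interior_mem_nhds.2 hU)
  obtain ⟨Z, hZ⟩ := exists_contMDiffSection_forall_mem_convex_of_local I (n := ⊤) (F_fiber := F) V
    (fun x ↦ {v | x ∈ C → v = s x})
    (by
      intro x v hv w hw a b _ _ hab hx
      rw [hv hx, hw hx, ← add_smul, hab, one_smul])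
    (by
      intro y
      by_cases hy : y ∈ C
      · exact ⟨U, mem_interior_iff_mem_nhds.1 (hCU hy), s, hs, fun _ _ _ ↦ rfl⟩
      · exact ⟨Cᶜ, hCc.isOpen_compl.mem_nhds hy, 0,
          (Bundle.contMDiff_zeroSection ℝ V).contMDiffOn, fun z hz h ↦ absurd h hz⟩)
  exact ⟨Z, Filter.mem_of_superset hC fun x hx ↦ hZ x hx⟩

theorem exists_contMDiffSection_apply_eq [ContMDiffVectorBundle ∞ F V I] (x₀ : M) (v : V x₀) :
    ∃ Z : Cₛ^∞⟮I; F, V⟯, Z x₀ = v := by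
  obtain ⟨U, hU, hs⟩ := FiberBundle.exists_contMDiffOn_extend (I := I) (k := ∞) F v
  obtain ⟨Z, hZ⟩ := exists_contMDiffSection_eventuallyEq hU hs
  exact ⟨Z, by simpa using hZ.self_of_nhds⟩

end Sections

theorem exists_contMDiffMap_mul_eventuallyEq_one (d : C^∞⟮I, M; ℝ⟯) {x₀ : M} (h : d x₀ ≠ 0) :
    ∃ u : C^∞⟮I, M; ℝ⟯, ∀ᶠ x in 𝓝 x₀, u x * d x = 1 := by
  have hU : {x | d x ≠ 0} ∈ 𝓝 x₀ := d.contMDiff.continuous.continuousAt.eventually_ne h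
  have hs : CMDiff[{x | d x ≠ 0}] ∞ (fun x ↦ (d x)⁻¹) := fun x hx ↦
    (d.contMDiff x).contMDiffWithinAt.inv₀ hx
  obtain ⟨Z, hZ⟩ := exists_contMDiffSection_eventuallyEq (V := fun _ : M ↦ ℝ) hU
    (fun x hx ↦ Bundle.contMDiffWithinAt_section.2 (hs x hx))
  refine ⟨⟨Z, fun x ↦ (Bundle.contMDiffAt_section _).1 (Z.contMDiff x)⟩, ?_⟩
  filter_upwards [hZ, hU] with x h1 h2
  change Z x * d x = 1
  rw [h1]
  exact inv_mul_cancel₀ h2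

theorem contMDiffAt_clm_of_apply {N G : Type*} [TopologicalSpace N] [ChartedSpace H N]
    [NormedAddCommGroup G] [NormedSpace ℝ G]
    {g : N → E →L[ℝ] G} {x₀ : N} (h : ∀ v, CMDiffAt ∞ (fun x ↦ g x v) x₀) : CMDiffAt ∞ g x₀ := by
  let b := Module.finBasis ℝ E
  have hg : g = fun x ↦ ∑ i, (LinearMap.toContinuousLinearMap (b.coord i)).smulRight (g x (b i)) := by
    ext x v
    conv_lhs => rw [← b.sum_repr v, map_sum]
    simp
  rw [hg]
  refine contMDiffAt_finsetSum fun i _ ↦ ?_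
  exact (ContinuousLinearMap.smulRightL ℝ E G
    (LinearMap.toContinuousLinearMap (b.coord i))).contMDiff.contMDiffAt.comp x₀ (h (b i))

theorem contMDiff_cotangent_of_apply {θ : Π x : M, CotangentSpace I x}
    (h : ∀ Z : VectorFields I M, CMDiff ∞ (fun x ↦ θ x (Z x))) :
    ContMDiff I (I.prod 𝓘(ℝ, E →L[ℝ] ℝ)) ∞
      (fun x ↦ Bundle.TotalSpace.mk' (E →L[ℝ] ℝ) (E := fun x : M ↦ CotangentSpace I x) x (θ x)) := by
  intro x₀
  rw [contMDiffAt_hom_bundle]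
  refine ⟨contMDiffAt_id, ?_⟩
  refine contMDiffAt_clm_of_apply fun v ↦ ?_
  set e := trivializationAt E (TangentSpace I) x₀
  have hs : CMDiff[e.baseSet] ∞ (T% fun x ↦ e.symmL ℝ x v) := by
    refine ContMDiffOn.clm_bundle_apply (F₁ := E) (E₁ := fun _ : M ↦ E) e.contMDiffOn_symmL ?_
    exact fun x _ ↦ Bundle.contMDiffWithinAt_section.2 contMDiffWithinAt_const
  obtain ⟨Z, hZ⟩ := exists_contMDiffSection_eventuallyEq
    (e.open_baseSet.mem_nhds (FiberBundle.mem_baseSet_trivializationAt' x₀)) hs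
  refine (h Z x₀).congr_of_eventuallyEq ?_
  filter_upwards [hZ] with x hx
  rw [hx]
  simp [ContinuousLinearMap.inCoordinates, e]

end Extension

section Calculus

set_option linter.unusedSectionVars false

variable {E : Type*} [NormedAddCommGroup E] [NormedSpace ℝ E] [FiniteDimensional ℝ E]
  {H : Type*} [TopologicalSpace H] {I : ModelWithCorners ℝ E H}
  {M : Type*} [TopologicalSpace M] [ChartedSpace H M] [IsManifold I ∞ M]

/-- The Lie bracket of smooth vector fields. -/
def VectorFields.lie (X Y : VectorFields I M) : VectorFields I M where
  toFun := VectorField.mlieBracket I X Y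
  contMDiff_toFun := by
    have : CompleteSpace E := FiniteDimensional.complete ℝ E
    have : IsManifold I (minSmoothness ℝ 2) M :=
      .of_le (n := ∞) (by simpa using ENat.LEInfty.out)
    have : IsManifold I (((⊤ : ℕ∞) : ℕ∞ω) + 1) M := inferInstanceAs (IsManifold I ∞ M)
    exact fun x ↦ ContMDiffAt.mlieBracket_vectorField (n := ⊤) (m := ⊤) (X.contMDiff x)
      (Y.contMDiff x) (by simp)

/-- The derivative of a smooth function along a smooth vector field. -/
def VectorFields.der (X : VectorFields I M) (f : C^∞⟮I, M; ℝ⟯) : C^∞⟮I, M; ℝ⟯ :=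
  ⟨fun x ↦ mvfderiv I f x (X x), contMDiff_mvfderiv f.contMDiff X.contMDiff⟩

/-- The function `μ(Z)`. -/
def OneForms.pair (μ : OneForms I M) (Z : VectorFields I M) : C^∞⟮I, M; ℝ⟯ :=
  ⟨fun x ↦ μ x (Z x), fun x ↦ (Bundle.contMDiffAt_section _).1
    (ContMDiffAt.clm_bundle_apply (F₂ := ℝ) (E₂ := fun _ : M ↦ ℝ) (μ.contMDiff x)
      (Z.contMDiff x))⟩

theorem VectorFields.der_apply (X : VectorFields I M) (f : C^∞⟮I, M; ℝ⟯) (x : M) :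
    X.der f x = mvfderiv I f x (X x) := rfl

theorem OneForms.pair_apply (μ : OneForms I M) (Z : VectorFields I M) (x : M) :
    μ.pair Z x = μ x (Z x) := rfl

namespace VectorFields

variable (X Y Z : VectorFields I M) (f g : C^∞⟮I, M; ℝ⟯) (c : ℝ)

theorem mdifferentiableAt_coe (f : C^∞⟮I, M; ℝ⟯) (x : M) : MDiffAt f x :=
  (f.contMDiff x).mdifferentiableAt (by simp)

theorem der_add : X.der (f + g) = X.der f + X.der g := by
  ext x
  simp [der_apply, mvfderiv_add (mdifferentiableAt_coe f x) (mdifferentiableAt_coe g x)]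

theorem der_neg : X.der (-f) = -X.der f := by
  ext x
  simp [der_apply, mvfderiv_neg]

theorem der_sub : X.der (f - g) = X.der f - X.der g := by
  rw [sub_eq_add_neg, der_add, der_neg, sub_eq_add_neg]

theorem der_mul : X.der (f * g) = f * X.der g + g * X.der f := by
  ext x
  simp [der_apply, mvfderiv_mul (mdifferentiableAt_coe f x) (mdifferentiableAt_coe g x)]

theorem der_lie : (X.lie Y).der f = X.der (Y.der f) - Y.der (X.der f) := by
  have : CompleteSpace E := FiniteDimensional.complete ℝ E
  ext x
  exact mvfderiv_mlieBracket X.mdifferentiableAt Y.mdifferentiableAt f.contMDiff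
    (mdifferentiableAt_coe (X.der f) x) (mdifferentiableAt_coe (Y.der f) x)

theorem lie_skew : X.lie Y = -Y.lie X := by
  ext x
  exact VectorField.mlieBracket_swap_apply

theorem lie_add_right : X.lie (Y + Z) = X.lie Y + X.lie Z := by
  have : CompleteSpace E := FiniteDimensional.complete ℝ E
  ext x
  exact VectorField.mlieBracket_add_right Y.mdifferentiableAt Z.mdifferentiableAt

theorem lie_smul_right : X.lie (c • Y) = c • X.lie Y := by
  have : CompleteSpace E := FiniteDimensional.complete ℝ E
  ext x
  exact VectorField.mlieBracket_const_smul_right Y.mdifferentiableAt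

theorem lie_neg_right : X.lie (-Y) = -X.lie Y := by
  simpa using X.lie_smul_right Y (-1)

theorem lie_lie : X.lie (Y.lie Z) = (X.lie Y).lie Z + Y.lie (X.lie Z) := by
  have : CompleteSpace E := FiniteDimensional.complete ℝ E
  have : IsManifold I (minSmoothness ℝ 3) M := .of_le (n := ∞) (by simpa using ENat.LEInfty.out)
  have h : minSmoothness ℝ 2 ≤ ∞ := by simpa using ENat.LEInfty.out
  ext x
  exact VectorField.leibniz_identity_mlieBracket_apply ((X.contMDiff x).of_le h)
    ((Y.contMDiff x).of_le h) ((Z.contMDiff x).of_le h)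

theorem lie_lie_left : (X.lie Y).lie Z = X.lie (Y.lie Z) - Y.lie (X.lie Z) :=
  eq_sub_of_add_eq (lie_lie X Y Z).symm

theorem der_zero : X.der 0 = 0 := by
  simpa using X.der_sub 0 0

theorem der_smul : X.der (c • f) = c • X.der f := by
  ext x
  have h := mvfderiv_mul (I := I) (mdifferentiableAt_const (c := c) (x := x))
    (mdifferentiableAt_coe f x)
  rw [mvfderiv_const, smul_zero, add_zero] at h
  exact congrArg (fun L ↦ L (X x)) h

theorem add_der : (X + Y).der f = X.der f + Y.der f := by
  ext x
  simp [der_apply]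

theorem smul_der : (c • X).der f = c • X.der f := by
  ext x
  simp [der_apply]

/-- The product of a smooth vector field and a smooth function. -/
def mulBy (f : C^∞⟮I, M; ℝ⟯) (X : VectorFields I M) : VectorFields I M :=
  ⟨fun x ↦ f x • X x, ContMDiff.smul_section f.contMDiff X.contMDiff⟩

theorem mulBy_apply (x : M) : mulBy f X x = f x • X x := rfl

theorem mulBy_der : (mulBy f X).der g = f * X.der g := by
  ext x
  simp [der_apply, mulBy_apply]

theorem lie_mulBy : X.lie (mulBy f Y) = mulBy f (X.lie Y) + mulBy (X.der f) Y := by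
  have : CompleteSpace E := FiniteDimensional.complete ℝ E
  ext x
  have := VectorField.mlieBracket_smul_right (V := X) (mdifferentiableAt_coe f x)
    (Y.mdifferentiableAt (x := x))
  exact this.trans (add_comm _ _)

end VectorFields

namespace OneForms

variable (μ ν : OneForms I M) (Y Z : VectorFields I M) (f : C^∞⟮I, M; ℝ⟯) (c : ℝ)

theorem pair_add : μ.pair (Y + Z) = μ.pair Y + μ.pair Z := by
  ext x; simp [pair_apply]

theorem pair_neg : μ.pair (-Z) = -μ.pair Z := by
  ext x; simp [pair_apply]

theorem pair_sub : μ.pair (Y - Z) = μ.pair Y - μ.pair Z := by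
  rw [sub_eq_add_neg, pair_add, pair_neg, sub_eq_add_neg]

theorem pair_smul : μ.pair (c • Z) = c • μ.pair Z := by
  ext x; simp [pair_apply]

theorem pair_mulBy : μ.pair (VectorFields.mulBy f Z) = f * μ.pair Z := by
  ext x; simp [pair_apply, VectorFields.mulBy_apply]

theorem add_pair : (μ + ν).pair Z = μ.pair Z + ν.pair Z := by
  ext x; simp [pair_apply]

theorem neg_pair : (-μ).pair Z = -μ.pair Z := by
  ext x; simp [pair_apply]

theorem smul_pair : (c • μ).pair Z = c • μ.pair Z := by
  ext x; simp [pair_apply]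

end OneForms

end Calculus

section CourantCalculus

set_option linter.unusedSectionVars false

variable {E : Type*} [NormedAddCommGroup E] [NormedSpace ℝ E] [FiniteDimensional ℝ E]
  {H : Type*} [TopologicalSpace H] {I : ModelWithCorners ℝ E H}
  {M : Type*} [TopologicalSpace M] [ChartedSpace H M] [IsManifold I ∞ M]

namespace BigSections

/-- The section `(X, α)` of the big tangent bundle. -/
def mk (X : VectorFields I M) (α : OneForms I M) : BigSections I M where
  toFun x := (X x, α x)
  contMDiff_toFun := by
    intro x
    have h := X.contMDiff x
    have h' := α.contMDiff x
    rw [Bundle.contMDiffAt_section] at h h' ⊢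
    exact h.prodMk_space h'

variable (A B C : BigSections I M) (f : C^∞⟮I, M; ℝ⟯) (c : ℝ)

/-- The function `g(A, B)`. -/
def metric : C^∞⟮I, M; ℝ⟯ := A.form.pair B.vec + B.form.pair A.vec

theorem metric_apply (x : M) : A.metric B x = neutralMetric I x (A x) (B x) := rfl

theorem metric_comm : A.metric B = B.metric A := add_comm _ _

theorem form_pair_of_metric_eq_zero {A B : BigSections I M} (h : A.metric B = 0) :
    B.form.pair A.vec = -A.form.pair B.vec :=
  eq_neg_of_add_eq_zero_right h

/-- The product of a section and a smooth function. -/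
def mulBy (f : C^∞⟮I, M; ℝ⟯) (A : BigSections I M) : BigSections I M :=
  ⟨fun x ↦ f x • A x, ContMDiff.smul_section f.contMDiff A.contMDiff⟩

theorem vec_add : (A + B).vec = A.vec + B.vec := rfl
theorem form_add : (A + B).form = A.form + B.form := rfl
theorem vec_neg : (-A).vec = -A.vec := rfl
theorem form_neg : (-A).form = -A.form := rfl
theorem vec_smul : (c • A).vec = c • A.vec := rfl
theorem form_smul : (c • A).form = c • A.form := rfl
theorem vec_mulBy : (mulBy f A).vec = VectorFields.mulBy f A.vec := rfl

theorem form_mulBy_pair (Z : VectorFields I M) : (mulBy f A).form.pair Z = f * A.form.pair Z := rfl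

theorem metric_mulBy : A.metric (mulBy f B) = f * A.metric B := by
  rw [metric, vec_mulBy, form_mulBy_pair, OneForms.pair_mulBy, metric, mul_add]

variable [T2Space M] [SigmaCompactSpace M]

theorem ext_of_pair {A B : BigSections I M} (hv : A.vec = B.vec)
    (hf : ∀ Z : VectorFields I M, A.form.pair Z = B.form.pair Z) : A = B := by
  ext x : 1
  refine Prod.ext (congrArg (fun X : VectorFields I M ↦ X x) hv) ?_
  ext v
  obtain ⟨Z, rfl⟩ := exists_contMDiffSection_apply_eq (I := I) (F := E)
    (V := fun x : M ↦ TangentSpace I x) x v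
  exact congrArg (fun h : C^∞⟮I, M; ℝ⟯ ↦ h x) (hf Z)

end BigSections

variable [T2Space M] [SigmaCompactSpace M]

/-- The Lie derivative of a smooth `1`-form, as a smooth `1`-form. -/
def OneForms.lieDer (X : VectorFields I M) (μ : OneForms I M) : OneForms I M where
  toFun := lieDerivative X μ
  contMDiff_toFun := by
    refine contMDiff_cotangent_of_apply fun Z ↦ ?_
    refine ContMDiff.congr (X.der (μ.pair Z) - μ.pair (X.lie Z)).contMDiff fun x ↦ ?_
    exact lieDerivative_apply X μ x Z

theorem OneForms.lieDer_pair (X : VectorFields I M) (μ : OneForms I M) (Z : VectorFields I M) :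
    (μ.lieDer X).pair Z = X.der (μ.pair Z) - μ.pair (X.lie Z) := by
  ext x
  exact lieDerivative_apply X μ x Z

/-- The differential of a smooth function, as a smooth `1`-form. -/
def OneForms.d (f : C^∞⟮I, M; ℝ⟯) : OneForms I M where
  toFun := mvfderiv I f
  contMDiff_toFun := contMDiff_cotangent_of_apply fun Z ↦ (Z.der f).contMDiff

theorem OneForms.d_pair (f : C^∞⟮I, M; ℝ⟯) (Z : VectorFields I M) :
    (OneForms.d f).pair Z = Z.der f := rfl

namespace BigSections

variable (A B C : BigSections I M) (f : C^∞⟮I, M; ℝ⟯) (c : ℝ)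

/-- The Courant bracket as a smooth section. -/
def courant (A B : BigSections I M) : BigSections I M :=
  mk (A.vec.lie B.vec) (B.form.lieDer A.vec - A.form.lieDer B.vec
    + (1 / 2 : ℝ) • OneForms.d (A.form.pair B.vec - B.form.pair A.vec))

theorem courant_vec : (A.courant B).vec = A.vec.lie B.vec := rfl

theorem courant_form_pair (Z : VectorFields I M) :
    (A.courant B).form.pair Z =
      A.vec.der (B.form.pair Z) - B.form.pair (A.vec.lie Z)
        - (B.vec.der (A.form.pair Z) - A.form.pair (B.vec.lie Z))
        + (1 / 2 : ℝ) • Z.der (A.form.pair B.vec - B.form.pair A.vec) := by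
  rw [← OneForms.lieDer_pair, ← OneForms.lieDer_pair, ← OneForms.d_pair, ← OneForms.smul_pair,
    sub_eq_add_neg, ← OneForms.neg_pair, ← OneForms.add_pair, ← OneForms.add_pair,
    ← sub_eq_add_neg]
  rfl

theorem courant_form_pair_of_metric_eq_zero {A B : BigSections I M} (h : A.metric B = 0)
    (Z : VectorFields I M) :
    (A.courant B).form.pair Z =
      A.vec.der (B.form.pair Z) - B.form.pair (A.vec.lie Z)
        - B.vec.der (A.form.pair Z) + A.form.pair (B.vec.lie Z)
        + Z.der (A.form.pair B.vec) := by
  rw [courant_form_pair, form_pair_of_metric_eq_zero h]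
  simp only [VectorFields.der_sub, VectorFields.der_neg]
  module

theorem courant_skew : A.courant B = -B.courant A := by
  refine ext_of_pair (by rw [vec_neg, courant_vec, courant_vec, VectorFields.lie_skew]) fun Z ↦ ?_
  rw [form_neg, OneForms.neg_pair, courant_form_pair, courant_form_pair]
  simp only [VectorFields.der_sub]
  module

theorem courant_add : A.courant (B + C) = A.courant B + A.courant C := by
  refine ext_of_pair ?_ fun Z ↦ ?_
  · simp only [vec_add, courant_vec, VectorFields.lie_add_right]
  · simp only [form_add, OneForms.add_pair, courant_form_pair, vec_add, VectorFields.der_add,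
      VectorFields.der_sub, OneForms.pair_add, VectorFields.add_der,
      VectorFields.lie_skew (B.vec + C.vec), VectorFields.lie_add_right, OneForms.pair_neg]
    rw [VectorFields.lie_skew Z B.vec, VectorFields.lie_skew Z C.vec, OneForms.pair_neg,
      OneForms.pair_neg]
    module

theorem courant_smul : A.courant (c • B) = c • A.courant B := by
  refine ext_of_pair ?_ fun Z ↦ ?_
  · simp only [vec_smul, courant_vec, VectorFields.lie_smul_right]
  · simp only [form_smul, OneForms.smul_pair, courant_form_pair, vec_smul, VectorFields.der_smul,
      VectorFields.der_sub, OneForms.pair_smul, VectorFields.smul_der,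
      VectorFields.lie_skew (c • B.vec), VectorFields.lie_smul_right, OneForms.pair_neg]
    rw [VectorFields.lie_skew Z B.vec, OneForms.pair_neg]
    module

theorem courant_sub : A.courant (B - C) = A.courant B - A.courant C := by
  rw [eq_sub_iff_add_eq, ← courant_add, sub_add_cancel]

theorem sub_courant : (A - B).courant C = A.courant C - B.courant C := by
  rw [courant_skew, courant_sub, courant_skew C A, courant_skew C B]
  abel

theorem courant_mulBy {A B : BigSections I M} (h : A.metric B = 0) :
    A.courant (mulBy f B) = mulBy f (A.courant B) + mulBy (A.vec.der f) B := by
  have h' : A.metric (mulBy f B) = 0 := by rw [metric_mulBy, h, mul_zero]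
  refine ext_of_pair ?_ fun Z ↦ ?_
  · exact VectorFields.lie_mulBy A.vec B.vec f
  · rw [form_add, OneForms.add_pair, form_mulBy_pair, form_mulBy_pair,
      courant_form_pair_of_metric_eq_zero h, courant_form_pair_of_metric_eq_zero h', vec_mulBy,
      form_mulBy_pair, form_mulBy_pair, VectorFields.lie_skew (VectorFields.mulBy f B.vec) Z,
      VectorFields.lie_mulBy, VectorFields.lie_skew Z B.vec, VectorFields.mulBy_der]
    simp only [OneForms.pair_add, OneForms.pair_neg, OneForms.pair_mulBy, VectorFields.der_mul]
    ring

theorem metric_courant_cyclic {A B C : BigSections I M} (hAB : A.metric B = 0)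
    (hBC : B.metric C = 0) (hCA : C.metric A = 0) :
    (A.courant B).metric C = (B.courant C).metric A := by
  have h1 := form_pair_of_metric_eq_zero hAB
  have h3 := form_pair_of_metric_eq_zero hCA
  rw [metric, metric, courant_form_pair_of_metric_eq_zero hAB,
    courant_form_pair_of_metric_eq_zero hBC, courant_vec, courant_vec,
    VectorFields.lie_skew A.vec C.vec, VectorFields.lie_skew B.vec A.vec]
  simp only [OneForms.pair_neg, h1, h3, VectorFields.der_neg]
  ring

theorem courant_jacobi {A B C : BigSections I M} (hAB : A.metric B = 0)
    (hBC : B.metric C = 0) (hCA : C.metric A = 0) (hA : A.metric (B.courant C) = 0)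
    (hB : B.metric (C.courant A) = 0) (hC : C.metric (A.courant B) = 0) :
    A.courant (B.courant C) + B.courant (C.courant A) + C.courant (A.courant B) = 0 := by
  have h1 := form_pair_of_metric_eq_zero hAB
  have h2 := form_pair_of_metric_eq_zero hBC
  have h3 := form_pair_of_metric_eq_zero hCA
  refine ext_of_pair ?_ fun W ↦ ?_
  · simp only [vec_add, courant_vec]
    rw [VectorFields.lie_lie A.vec, VectorFields.lie_skew C.vec (A.vec.lie B.vec),
      VectorFields.lie_skew C.vec A.vec, VectorFields.lie_neg_right]
    change _ = (0 : VectorFields I M)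
    abel
  · have hT := congrArg W.der hA
    rw [metric, courant_form_pair_of_metric_eq_zero hBC, courant_vec,
      VectorFields.lie_skew B.vec A.vec] at hT
    simp only [VectorFields.der_add, VectorFields.der_sub, VectorFields.der_neg,
      VectorFields.der_zero, OneForms.pair_neg, h1] at hT
    simp only [form_add, OneForms.add_pair]
    rw [courant_form_pair_of_metric_eq_zero hA, courant_form_pair_of_metric_eq_zero hB,
      courant_form_pair_of_metric_eq_zero hC]
    simp only [courant_vec, courant_form_pair_of_metric_eq_zero hAB,
      courant_form_pair_of_metric_eq_zero hBC, courant_form_pair_of_metric_eq_zero hCA,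
      VectorFields.der_add, VectorFields.der_sub, VectorFields.der_lie,
      VectorFields.lie_lie_left, OneForms.pair_sub]
    trans (0 : C^∞⟮I, M; ℝ⟯)
    · linear_combination hT
    · rfl

end BigSections

end CourantCalculus

section ImageBundle

set_option linter.unusedSectionVars false

variable {E : Type*} [NormedAddCommGroup E] [NormedSpace ℝ E] [FiniteDimensional ℝ E]
  {H : Type*} [TopologicalSpace H] {I : ModelWithCorners ℝ E H}
  {M : Type*} [TopologicalSpace M] [ChartedSpace H M] [IsManifold I ∞ M]

instance (x : M) : FiniteDimensional ℝ (BigTangentSpace I x) :=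
  inferInstanceAs (FiniteDimensional ℝ (E × (E →L[ℝ] ℝ)))

theorem eq_zero_of_neutralMetric_eq_zero (x : M) {v : BigTangentSpace I x}
    (h : ∀ w, neutralMetric I x w v = 0) : v = 0 := by
  refine Prod.ext ?_ ?_
  · by_contra hne
    have hsep : ∀ e : E, e ≠ 0 → ∃ f : E →L[ℝ] ℝ, f e ≠ 0 := fun e he ↦
      SeparatingDual.exists_ne_zero he
    obtain ⟨f, hf⟩ := hsep v.1 hne
    have h1 : f v.1 + v.2 0 = 0 := h (0, f)
    rw [map_zero, add_zero] at h1
    exact hf h1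
  · ext z
    simpa [neutralMetric] using h (z, 0)

theorem exists_neutralMetric_eq (x : M) (φ : BigTangentSpace I x →ₗ[ℝ] ℝ) :
    ∃ w, ∀ v, neutralMetric I x v w = φ v := by
  have hinj : Function.Injective (LinearMap.flip (neutralMetric I x)) := by
    rw [← LinearMap.ker_eq_bot, LinearMap.ker_eq_bot']
    intro v hv
    exact eq_zero_of_neutralMetric_eq_zero x fun w ↦ LinearMap.congr_fun hv w
  obtain ⟨w, hw⟩ := (LinearMap.injective_iff_surjective_of_finrank_eq_finrank
    (Subspace.dual_finrank_eq (K := ℝ) (V := BigTangentSpace I x)).symm).1 hinj φ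
  exact ⟨w, fun v ↦ LinearMap.congr_fun hw v⟩

namespace TwoNilpotentStructure

variable (τ : TwoNilpotentStructure I M)

theorem apply_apply (X : BigSections I M) (x : M) : τ.apply X x = τ.toFun x (X x) := rfl

theorem ofImage_mem (s : τ.imageSections) (x : M) : τ.ofImage s x ∈ τ.image x :=
  Subtype.property (p := (· ∈ τ.image x)) (s.1 x)

theorem incl_injective (x : M) : Function.Injective (τ.incl x) := Subtype.val_injective

theorem range_incl (x : M) : LinearMap.range (τ.incl x) = τ.image x :=
  Submodule.range_subtype _

/-- A section of the big tangent bundle with values in `E`, as a section of `E`. -/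
def toImage (A : BigSections I M) (hA : ∀ x, A x ∈ τ.image x) : τ.imageSections :=
  ⟨fun x ↦ (⟨A x, hA x⟩ : τ.image x), A.contMDiff⟩

variable [T2Space M] [SigmaCompactSpace M]

/-- Near every point, `E = im τ` has a frame `τ V₁, …, τ Vᵣ`, and sections of `E` have smooth
coefficients in it: by Cramer's rule for the matrix `g(τ Vᵢ, Wⱼ)`, which is `1` at the point. -/
theorem exists_image_frame {r : ℕ} (hr : ∀ x, Module.finrank ℝ (τ.image x) = r) (x₀ : M) :
    ∃ V : Fin r → BigSections I M,
      (∀ᶠ x in 𝓝 x₀, LinearIndependent ℝ (fun i ↦ τ.apply (V i) x) ∧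
        Submodule.span ℝ (Set.range fun i ↦ τ.apply (V i) x) = τ.image x) ∧
      ∀ A : BigSections I M, (∀ x, A x ∈ τ.image x) → ∃ f : Fin r → C^∞⟮I, M; ℝ⟯,
        ∀ᶠ x in 𝓝 x₀, A x = ∑ i, f i x • τ.apply (V i) x := by
  classical
  have : Module.Free ℝ (τ.image x₀) := inferInstanceAs (Module.Free ℝ (τ.Image x₀))
  let b : Module.Basis (Fin r) ℝ (τ.image x₀) := Module.finBasisOfFinrankEq ℝ _ (hr x₀)
  have hV : ∀ i, ∃ V : BigSections I M, τ.apply V x₀ = b i := by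
    intro i
    obtain ⟨v, hv⟩ := (b i).2
    obtain ⟨V, hV⟩ := exists_contMDiffSection_apply_eq (I := I) (F := BigModel E)
      (V := fun x : M ↦ BigTangentSpace I x) x₀ v
    exact ⟨V, by rw [apply_apply, hV, hv]⟩
  choose V hV using hV
  have hW : ∀ j, ∃ W : BigSections I M, ∀ i,
      (τ.apply (V i)).metric W x₀ = (1 : Matrix (Fin r) (Fin r) ℝ) i j := by
    intro j
    obtain ⟨φ, hφ⟩ := LinearMap.exists_extend (b.coord j)
    obtain ⟨w, hw⟩ := exists_neutralMetric_eq x₀ φ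
    obtain ⟨W, hW⟩ := exists_contMDiffSection_apply_eq (I := I) (F := BigModel E)
      (V := fun x : M ↦ BigTangentSpace I x) x₀ w
    refine ⟨W, fun i ↦ ?_⟩
    rw [BigSections.metric_apply, hW, hw, hV]
    have := LinearMap.congr_fun hφ (b i)
    simp only [LinearMap.comp_apply, Submodule.subtype_apply] at this
    rw [this, Module.Basis.coord_apply, Module.Basis.repr_self, Finsupp.single_apply,
      Matrix.one_apply]
  choose W hW using hW
  let ev (x : M) : C^∞⟮I, M; ℝ⟯ →+* ℝ := ContMDiffMap.evalRingHom x
  let G : Matrix (Fin r) (Fin r) C^∞⟮I, M; ℝ⟯ :=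
    Matrix.of fun i j ↦ (τ.apply (V i)).metric (W j)
  have hdet : ∀ x, G.det x = ((ev x).mapMatrix G).det := fun x ↦ (ev x).map_det G
  have hG₀ : (ev x₀).mapMatrix G = 1 := by
    ext i j
    exact hW j i
  have hdet₀ : G.det x₀ ≠ 0 := by
    rw [hdet, hG₀, Matrix.det_one]
    exact one_ne_zero
  have hcoef : ∀ (x : M) (c : Fin r → ℝ) (j : Fin r),
      neutralMetric I x (∑ i, c i • τ.apply (V i) x) (W j x) =
        Matrix.vecMul c ((ev x).mapMatrix G) j := by
    intro x c j
    simp only [map_sum, map_smul, LinearMap.sum_apply, LinearMap.smul_apply, Matrix.vecMul,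
      dotProduct, smul_eq_mul]
    rfl
  have hli : ∀ x, G.det x ≠ 0 → LinearIndependent ℝ (fun i ↦ τ.apply (V i) x) := by
    intro x hx
    rw [Fintype.linearIndependent_iff]
    intro c hc
    have : Matrix.vecMul c ((ev x).mapMatrix G) = 0 := by
      ext j
      rw [← hcoef, hc]
      simp
    rw [hdet] at hx
    exact congrFun (Matrix.eq_zero_of_vecMul_eq_zero hx this)
  have hspan : ∀ x, G.det x ≠ 0 →
      Submodule.span ℝ (Set.range fun i ↦ τ.apply (V i) x) = τ.image x := by
    intro x hx
    refine Submodule.eq_of_le_of_finrank_eq ?_ ?_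
    · rw [Submodule.span_le]
      rintro _ ⟨i, rfl⟩
      exact ⟨V i x, rfl⟩
    · rw [finrank_span_eq_card (hli x hx), hr, Fintype.card_fin]
  have hne : ∀ᶠ x in 𝓝 x₀, G.det x ≠ 0 :=
    G.det.contMDiff.continuous.continuousAt.eventually_ne hdet₀
  refine ⟨V, hne.mono fun x hx ↦ ⟨hli x hx, hspan x hx⟩, fun A hA ↦ ?_⟩
  obtain ⟨u, hu⟩ := exists_contMDiffMap_mul_eventuallyEq_one G.det hdet₀
  refine ⟨fun i ↦ u * Matrix.vecMul (fun j ↦ A.metric (W j)) G.adjugate i, ?_⟩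
  filter_upwards [hne, hu] with x hx hux
  have hAx := hA x
  rw [← hspan x hx, Submodule.mem_span_range_iff_exists_fun] at hAx
  obtain ⟨c, hc⟩ := hAx
  rw [← hc]
  refine Finset.sum_congr rfl fun i _ ↦ ?_
  congr 1
  have h1 : (fun j ↦ A.metric (W j) x) = Matrix.vecMul c ((ev x).mapMatrix G) := by
    ext j
    rw [← hcoef, hc]
    rfl
  have h2 : (Matrix.vecMul (fun j ↦ A.metric (W j)) G.adjugate i) x = G.det x * c i := by
    have := (ev x).map_vecMul G.adjugate (fun j ↦ A.metric (W j)) i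
    refine this.trans ?_
    have h3 : (G.adjugate.map (ev x)) = ((ev x).mapMatrix G).adjugate := (ev x).map_adjugate G
    change Matrix.vecMul (fun j ↦ A.metric (W j) x) _ i = _
    rw [h3, h1, Matrix.vecMul_vecMul, Matrix.mul_adjugate, Matrix.vecMul_smul, Matrix.vecMul_one,
      hdet]
    rfl
  change c i = u x * _
  rw [h2, ← mul_assoc, hux, one_mul]

theorem isSmoothVectorBundle_imageSections : IsSmoothVectorBundle I τ.imageSections where
  smul_mem f s hs := by
    have := ContMDiff.smul_section f.contMDiff (show τ.imageSections.carrier s from hs)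
    refine this.congr fun x ↦ ?_
    simp
  mem_of_locally s hs x₀ := by
    obtain ⟨t, ht, hst⟩ := hs x₀
    refine (ht x₀).congr_of_eventuallyEq ?_
    filter_upwards [hst] with x hx
    rw [hx]
  exists_frame := by
    obtain ⟨r, hr⟩ := τ.const_rank
    refine ⟨r, fun x₀ ↦ ?_⟩
    obtain ⟨V, hV, hA⟩ := τ.exists_image_frame hr x₀
    have hmem : ∀ i x, τ.apply (V i) x ∈ τ.image x := fun i x ↦ ⟨V i x, rfl⟩
    refine ⟨fun i ↦ (τ.toImage (τ.apply (V i)) (hmem i)).1, fun i ↦ Subtype.property _, ?_, ?_⟩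
    · filter_upwards [hV] with x hx
      refine ⟨LinearIndependent.of_comp (τ.incl x) hx.1, ?_⟩
      refine Submodule.map_injective_of_injective (τ.incl_injective x) ?_
      rw [Submodule.map_span, ← Set.range_comp, Submodule.map_top, τ.range_incl]
      exact hx.2
    · intro s hs
      obtain ⟨f, hf⟩ := hA (τ.ofImage ⟨s, hs⟩) (τ.ofImage_mem _)
      refine ⟨f, ?_⟩
      filter_upwards [hf] with x hx
      refine τ.incl_injective x ?_
      rw [map_sum]
      simp only [map_smul]
      exact hx

theorem exists_apply_eq_ofImage (s : τ.imageSections) :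
    ∃ X : BigSections I M, τ.apply X = τ.ofImage s := by
  obtain ⟨r, hr⟩ := τ.const_rank
  obtain ⟨X, hX⟩ := exists_contMDiffSection_forall_mem_convex_of_local I (n := ⊤)
    (F_fiber := BigModel E)
    (fun x : M ↦ BigTangentSpace I x) (fun x ↦ {v | τ.toFun x v = τ.ofImage s x})
    (by
      intro x v hv w hw a b _ _ hab
      change τ.toFun x _ = _ at hv hw ⊢
      rw [map_add, map_smul, map_smul, hv, hw, ← add_smul, hab, one_smul])
    (by
      intro x₀
      obtain ⟨V, -, hA⟩ := τ.exists_image_frame hr x₀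
      obtain ⟨f, hf⟩ := hA _ (τ.ofImage_mem s)
      refine ⟨_, hf, fun x ↦ ∑ i, f i x • V i x, ContMDiff.contMDiffOn ?_, fun y hy ↦ ?_⟩
      · exact ContMDiff.sum_section fun i _ ↦
          ContMDiff.smul_section (f i).contMDiff (V i).contMDiff
      · have hy : τ.ofImage s y = _ := hy
        rw [Set.mem_ofPred_eq, hy, map_sum]
        simp only [map_smul]
        rfl)
  exact ⟨X, by ext x : 1; exact hX x⟩

end TwoNilpotentStructure

end ImageBundle

section Transfer

set_option linter.unusedSectionVars false

variable {E : Type*} [NormedAddCommGroup E] [NormedSpace ℝ E]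
  {H : Type*} [TopologicalSpace H] {I : ModelWithCorners ℝ E H}
  {M : Type*} [TopologicalSpace M] [ChartedSpace H M] [IsManifold I ∞ M]
  {V : M → Type*} [∀ x, AddCommGroup (V x)] [∀ x, Module ℝ (V x)]
  {V' : M → Type*} [∀ x, AddCommGroup (V' x)] [∀ x, Module ℝ (V' x)]

theorem IsSmoothVectorBundle.of_equiv {Γ : Submodule ℝ (Π x : M, V x)}
    {Γ' : Submodule ℝ (Π x : M, V' x)} (φ : Π x : M, V x ≃ₗ[ℝ] V' x)
    (hφ : ∀ s : Π x : M, V x, s ∈ Γ ↔ (fun x ↦ φ x (s x)) ∈ Γ')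
    (h : IsSmoothVectorBundle I Γ') : IsSmoothVectorBundle I Γ where
  smul_mem f s hs := by
    rw [hφ] at hs ⊢
    simpa only [map_smul] using h.smul_mem f _ hs
  mem_of_locally s hs := by
    rw [hφ]
    refine h.mem_of_locally _ fun x₀ ↦ ?_
    obtain ⟨t, ht, hst⟩ := hs x₀
    exact ⟨_, (hφ t).1 ht, hst.mono fun x hx ↦ congrArg (φ x) hx⟩
  exists_frame := by
    obtain ⟨k, hk⟩ := h.exists_frame
    refine ⟨k, fun x₀ ↦ ?_⟩
    obtain ⟨e, he, hframe, hcoef⟩ := hk x₀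
    refine ⟨fun i x ↦ (φ x).symm (e i x), fun i ↦ by simpa [hφ] using he i, ?_, fun s hs ↦ ?_⟩
    · filter_upwards [hframe] with x hx
      refine ⟨hx.1.map' ((φ x).symm : V' x →ₗ[ℝ] V x) (φ x).symm.ker, ?_⟩
      have := Submodule.map_span ((φ x).symm : V' x →ₗ[ℝ] V x) (Set.range fun i ↦ e i x)
      rw [hx.2, Submodule.map_top, LinearEquiv.range, ← Set.range_comp] at this
      exact this.symm
    · obtain ⟨f, hf⟩ := hcoef _ ((hφ s).1 hs)
      refine ⟨f, hf.mono fun x hx ↦ ?_⟩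
      simpa using congrArg (φ x).symm hx

theorem IsLieAlgebroidIso.isLieAlgebroid {Γ : Submodule ℝ (Π x : M, V x)}
    {br : Γ → Γ → Π x : M, V x} {ρ : Π x : M, V x →ₗ[ℝ] TangentSpace I x}
    {Γ' : Submodule ℝ (Π x : M, V' x)} {br' : Γ' → Γ' → Π x : M, V' x}
    {ρ' : Π x : M, V' x →ₗ[ℝ] TangentSpace I x} {φ : Π x : M, V x ≃ₗ[ℝ] V' x}
    (hφ : IsLieAlgebroidIso I Γ br ρ Γ' br' ρ' φ) (h : IsLieAlgebroid I Γ' br' ρ') :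
    IsLieAlgebroid I Γ br ρ := by
  let Φ (s : Γ) : Γ' := ⟨fun y ↦ φ y (s.1 y), (hφ.mem_iff s.1).1 s.2⟩
  have hbr : ∀ s t x, φ x (br s t x) = br' (Φ s) (Φ t) x := hφ.map_bracket
  have hmem : ∀ s t, br s t ∈ Γ := by
    intro s t
    rw [hφ.mem_iff]
    exact (funext (hbr s t) : _ = br' (Φ s) (Φ t)) ▸ h.bracket_mem _ _
  have hΦbr : ∀ s t, Φ ⟨br s t, hmem s t⟩ = ⟨br' (Φ s) (Φ t), h.bracket_mem _ _⟩ :=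
    fun s t ↦ Subtype.ext (funext (hbr s t))
  have hΦadd : ∀ s t, Φ (s + t) = Φ s + Φ t := fun s t ↦
    Subtype.ext (funext fun x ↦ map_add (φ x) _ _)
  have hΦsmul : ∀ (c : ℝ) s, Φ (c • s) = c • Φ s := fun c s ↦
    Subtype.ext (funext fun x ↦ map_smul (φ x) _ _)
  refine ⟨h.isSmoothVectorBundle.of_equiv φ hφ.mem_iff, fun s ↦ ?_, hmem, fun s t u ↦ ?_,
    fun c s t ↦ ?_, fun s t ↦ ?_, fun s t u ↦ ?_, fun s t f x ↦ ?_, fun s t x ↦ ?_⟩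
  · refine (h.anchor_smooth (Φ s)).congr fun x ↦ ?_
    exact congrArg _ (hφ.map_anchor x _).symm
  · ext x
    refine (φ x).injective ?_
    rw [Pi.add_apply, map_add, hbr, hbr, hbr, hΦadd, h.bracket_add]
    rfl
  · ext x
    refine (φ x).injective ?_
    rw [Pi.smul_apply, map_smul, hbr, hbr, hΦsmul, h.bracket_smul]
    rfl
  · ext x
    refine (φ x).injective ?_
    rw [Pi.neg_apply, map_neg, hbr, hbr, h.bracket_skew]
    rfl
  · ext x
    refine (φ x).injective ?_
    rw [Pi.add_apply, Pi.add_apply, map_add, map_add, hbr, hbr, hbr, hΦbr, hΦbr, hΦbr, Pi.zero_apply,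
      map_zero]
    exact congrFun (h.jacobi (Φ s) (Φ t) (Φ u)) x
  · refine (φ x).injective ?_
    rw [map_add, map_smul, map_smul, hbr, hbr, ← hφ.map_anchor]
    have := h.leibniz (Φ s) (Φ t) f x
    refine Eq.trans ?_ this
    congr 2
    exact Subtype.ext (funext fun y ↦ map_smul (φ y) _ _)
  · rw [← hφ.map_anchor, hbr, h.anchor_bracket]
    simp only [Φ, hφ.map_anchor]

end Transfer

section MainResults

set_option linter.unusedSectionVars false

variable {E : Type*} [NormedAddCommGroup E] [NormedSpace ℝ E] [FiniteDimensional ℝ E]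
  {H : Type*} [TopologicalSpace H] {I : ModelWithCorners ℝ E H}
  {M : Type*} [TopologicalSpace M] [ChartedSpace H M] [IsManifold I ∞ M]

namespace TwoNilpotentStructure

variable (τ : TwoNilpotentStructure I M)

theorem neutralMetric_toFun (x : M) (v w : BigTangentSpace I x) :
    neutralMetric I x (τ.toFun x v) w = -neutralMetric I x v (τ.toFun x w) :=
  eq_neg_of_add_eq_zero_right (τ.skew x v w)

theorem neutralMetric_eq_zero_of_mem_image {x : M} {v w : BigTangentSpace I x}
    (hv : v ∈ τ.image x) (hw : τ.toFun x w = 0) : neutralMetric I x v w = 0 := by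
  obtain ⟨v, rfl⟩ := hv
  rw [neutralMetric_toFun, hw, map_zero, neg_zero]

theorem toFun_eq_zero_of_mem_image {x : M} {v : BigTangentSpace I x} (hv : v ∈ τ.image x) :
    τ.toFun x v = 0 := by
  obtain ⟨v, rfl⟩ := hv
  exact τ.sq_zero x v

theorem metric_eq_zero_of_mem_image {A B : BigSections I M} (hA : ∀ x, A x ∈ τ.image x)
    (hB : ∀ x, B x ∈ τ.image x) : A.metric B = 0 := by
  ext x
  exact τ.neutralMetric_eq_zero_of_mem_image (hA x) (τ.toFun_eq_zero_of_mem_image (hB x))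

theorem apply_mem (X : BigSections I M) (x : M) : τ.apply X x ∈ τ.image x := ⟨X x, rfl⟩

theorem apply_sub (X Y : BigSections I M) : τ.apply (X - Y) = τ.apply X - τ.apply Y := by
  ext x : 1
  exact map_sub (τ.toFun x) _ _

theorem proj_eq_proj_iff (x : M) (v w : BigTangentSpace I x) :
    τ.proj x v = τ.proj x w ↔ τ.toFun x v = τ.toFun x w := by
  rw [← tauPrime_mk, ← tauPrime_mk, (τ.incl_injective x).eq_iff, (τ.tauPrime x).injective.eq_iff]

variable [T2Space M] [SigmaCompactSpace M]

theorem toFun_courant_eq_zero (hτ : τ.IsWeaklyIntegrable) {U : BigSections I M}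
    (hU : ∀ x, τ.toFun x (U x) = 0) (Y : BigSections I M) (x : M) :
    τ.toFun x (U.courant (τ.apply Y) x) = 0 := by
  refine eq_zero_of_neutralMetric_eq_zero x fun w ↦ ?_
  obtain ⟨W, rfl⟩ := exists_contMDiffSection_apply_eq (I := I) (F := BigModel E)
    (V := fun x : M ↦ BigTangentSpace I x) x w
  have hmem : ∀ Z : BigSections I M, (τ.apply Z).metric U = 0 := fun Z ↦ by
    ext y
    exact τ.neutralMetric_eq_zero_of_mem_image (τ.apply_mem Z y) (hU y)
  have h := BigSections.metric_courant_cyclic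
    ((BigSections.metric_comm _ _).trans (hmem Y))
    (τ.metric_eq_zero_of_mem_image (τ.apply_mem Y) (τ.apply_mem W)) (hmem W)
  rw [BigSections.metric_comm] at h
  have hx : neutralMetric I x (τ.toFun x (W x)) (U.courant (τ.apply Y) x) =
      neutralMetric I x ((τ.apply Y).courant (τ.apply W) x) (U x) :=
    congrArg (fun f : C^∞⟮I, M; ℝ⟯ ↦ f x) h
  have h0 : neutralMetric I x ((τ.apply Y).courant (τ.apply W) x) (U x) = 0 :=
    τ.neutralMetric_eq_zero_of_mem_image
      (hτ (τ.toImage _ (τ.apply_mem Y)) (τ.toImage _ (τ.apply_mem W)) x) (hU x)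
  rw [neutralMetric_toFun, h0] at hx
  exact neg_eq_zero.1 hx

theorem proj_tauBracket_congr (hτ : τ.IsWeaklyIntegrable) {X X' Y Y' : BigSections I M}
    (hX : τ.apply X = τ.apply X') (hY : τ.apply Y = τ.apply Y') (x : M) :
    τ.proj x (τ.tauBracket X Y x) = τ.proj x (τ.tauBracket X' Y' x) := by
  have hker : ∀ {Z Z' : BigSections I M}, τ.apply Z = τ.apply Z' →
      ∀ x, τ.toFun x ((Z - Z') x) = 0 := by
    intro Z Z' h x
    rw [← apply_apply, apply_sub, h, sub_self]
    rfl
  have h1 := τ.toFun_courant_eq_zero hτ (hker hY) X x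
  have h2 := τ.toFun_courant_eq_zero hτ (hker hX) Y x
  rw [BigSections.courant_skew] at h1
  have h : (τ.apply X).courant Y + X.courant (τ.apply Y)
      - ((τ.apply X').courant Y' + X'.courant (τ.apply Y')) =
      (τ.apply X).courant (Y - Y') + (X - X').courant (τ.apply Y) := by
    rw [← hX, ← hY, BigSections.courant_sub, BigSections.sub_courant]
    abel
  rw [proj_eq_proj_iff, ← sub_eq_zero, ← map_sub]
  refine (congrArg (fun A : BigSections I M ↦ τ.toFun x (A x)) h).trans ?_
  refine (map_add (τ.toFun x) _ _).trans ?_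
  rw [h2, add_zero]
  exact neg_eq_zero.1 ((map_neg (τ.toFun x) _).symm.trans h1)

theorem inducedBracket_mkQuot (hτ : τ.IsWeaklyIntegrable) (X Y : BigSections I M) (x : M) :
    τ.inducedBracket (τ.mkQuot X) (τ.mkQuot Y) x = τ.proj x (τ.tauBracket X Y x) := by
  have h : ∀ Z : BigSections I M, τ.apply (τ.exists_mkQuot_eq (τ.mkQuot Z)).choose = τ.apply Z := by
    intro Z
    ext x : 1
    exact (τ.proj_eq_proj_iff x _ _).1
      (congrFun (congrArg Subtype.val (τ.exists_mkQuot_eq (τ.mkQuot Z)).choose_spec) x)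
  exact τ.proj_tauBracket_congr hτ (h X) (h Y) x

theorem isIntegrable_iff (hτ : τ.IsWeaklyIntegrable) :
    τ.IsIntegrable ↔ τ.inducedBracket = τ.quotBracket hτ := by
  have key : ∀ (X Y : BigSections I M) (x : M), τ.courantNijenhuis X Y x = 0 ↔
      τ.inducedBracket (τ.mkQuot X) (τ.mkQuot Y) x =
        τ.quotBracket hτ (τ.mkQuot X) (τ.mkQuot Y) x := by
    intro X Y x
    rw [τ.inducedBracket_mkQuot hτ, ← (τ.tauPrime x).injective.eq_iff,
      ← (τ.incl_injective x).eq_iff, tauPrime_mk, quotBracket, LinearEquiv.apply_symm_apply]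
    change _ ↔ _ = courantBracket (τ.apply X) (τ.apply Y) x
    rw [courantNijenhuis, τ.sq_zero, add_zero, sub_sub, sub_eq_zero, tauBracket, map_add,
      add_comm, eq_comm]
  refine ⟨fun h ↦ ?_, fun h X Y x ↦ (key X Y x).2 (by rw [h])⟩
  funext s t x
  obtain ⟨X, rfl⟩ := τ.exists_mkQuot_eq s
  obtain ⟨Y, rfl⟩ := τ.exists_mkQuot_eq t
  exact (key X Y x).1 (h X Y x)

variable {τ} in
theorem IsIntegrable.isWeaklyIntegrable (h : τ.IsIntegrable) : τ.IsWeaklyIntegrable := by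
  intro s t x
  obtain ⟨X, hX⟩ := τ.exists_apply_eq_ofImage s
  obtain ⟨Y, hY⟩ := τ.exists_apply_eq_ofImage t
  have h0 := h X Y x
  rw [courantNijenhuis, τ.sq_zero, add_zero, sub_sub, sub_eq_zero, ← map_add] at h0
  rw [← hX, ← hY, h0]
  exact ⟨_, rfl⟩

theorem isLieAlgebroid_image (hτ : τ.IsWeaklyIntegrable) :
    IsLieAlgebroid I τ.imageSections (τ.imageBracket hτ) τ.imageAnchor := by
  have hiso : ∀ s t, (τ.ofImage s).metric (τ.ofImage t) = 0 := fun s t ↦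
    τ.metric_eq_zero_of_mem_image (τ.ofImage_mem s) (τ.ofImage_mem t)
  have hbr : ∀ s t x,
      τ.incl x (τ.imageBracket hτ s t x) = (τ.ofImage s).courant (τ.ofImage t) x :=
    fun s t x ↦ rfl
  have hmem : ∀ s t, τ.imageBracket hτ s t ∈ τ.imageSections := fun s t ↦
    ((τ.ofImage s).courant (τ.ofImage t)).contMDiff
  have hofbr : ∀ s t, τ.ofImage ⟨τ.imageBracket hτ s t, hmem s t⟩ =
      (τ.ofImage s).courant (τ.ofImage t) := fun s t ↦ rfl
  refine ⟨τ.isSmoothVectorBundle_imageSections, fun s ↦ (τ.ofImage s).vec.contMDiff, hmem,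
    fun s t u ↦ ?_, fun c s t ↦ ?_, fun s t ↦ ?_, fun s t u ↦ ?_, fun s t f x ↦ ?_,
    fun s t x ↦ rfl⟩
  · ext x
    refine τ.incl_injective x ?_
    rw [Pi.add_apply, map_add, hbr, hbr, hbr]
    exact congrArg (fun A : BigSections I M ↦ A x)
      (BigSections.courant_add (τ.ofImage s) (τ.ofImage t) (τ.ofImage u))
  · ext x
    refine τ.incl_injective x ?_
    rw [Pi.smul_apply, map_smul, hbr, hbr]
    exact congrArg (fun A : BigSections I M ↦ A x)
      (BigSections.courant_smul (τ.ofImage s) (τ.ofImage t) c)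
  · ext x
    refine τ.incl_injective x ?_
    rw [Pi.neg_apply, map_neg, hbr, hbr]
    exact congrArg (fun A : BigSections I M ↦ A x)
      (BigSections.courant_skew (τ.ofImage s) (τ.ofImage t))
  · ext x
    refine τ.incl_injective x ?_
    rw [Pi.add_apply, Pi.add_apply, map_add, map_add, hbr, hbr, hbr, hofbr, hofbr, hofbr,
      Pi.zero_apply, map_zero]
    exact congrArg (fun A : BigSections I M ↦ A x)
      (BigSections.courant_jacobi (hiso s t) (hiso t u) (hiso u s)
        (hiso s ⟨_, hmem t u⟩) (hiso t ⟨_, hmem u s⟩) (hiso u ⟨_, hmem s t⟩))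
  · refine τ.incl_injective x ?_
    rw [map_add, map_smul, map_smul, hbr, hbr]
    refine Eq.trans ?_ (congrArg (fun A : BigSections I M ↦ A x)
      (BigSections.courant_mulBy f (hiso s t)))
    congr 2

theorem isLieAlgebroidIso_tauPrime (hτ : τ.IsWeaklyIntegrable) :
    IsLieAlgebroidIso I τ.quotSections (τ.quotBracket hτ) τ.quotAnchor τ.imageSections
      (τ.imageBracket hτ) τ.imageAnchor τ.tauPrime where
  mem_iff s := by
    refine ⟨fun hs ↦ (τ.tauPrimeSection ⟨s, hs⟩).2, fun hs ↦ ?_⟩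
    obtain ⟨X, hX⟩ := τ.exists_apply_eq_ofImage ⟨_, hs⟩
    have hsX : s = (τ.mkQuot X).1 := by
      funext x
      refine (τ.tauPrime x).injective (τ.incl_injective x ?_)
      exact (congrArg (fun A : BigSections I M ↦ A x) hX).symm
    exact hsX ▸ (τ.mkQuot X).2
  map_anchor x v := rfl
  map_bracket s t x := (τ.tauPrime x).apply_symm_apply _

end TwoNilpotentStructure

end MainResults

end

end BigTangent

theorem proposition4p2 {E : Type*} [NormedAddCommGroup E] [NormedSpace ℝ E]
    [FiniteDimensional ℝ E] {H : Type*} [TopologicalSpace H] (I : ModelWithCorners ℝ E H)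
    (M : Type*) [TopologicalSpace M] [ChartedSpace H M] [IsManifold I ∞ M]
    [BoundarylessManifold I M] [T2Space M] [SigmaCompactSpace M]
    (τ : BigTangent.TwoNilpotentStructure I M) :
    -- for weakly integrable `τ`, the induced `τ`-bracket is well defined
    (τ.IsWeaklyIntegrable → ∀ (X Y : BigTangent.BigSections I M) (x : M),
      τ.inducedBracket (τ.mkQuot X) (τ.mkQuot Y) x =
        τ.proj x (τ.tauBracket X Y x)) ∧
    -- first part
    (τ.IsIntegrable → ∃ hτ : τ.IsWeaklyIntegrable,
      BigTangent.IsLieAlgebroid I τ.quotSections τ.inducedBracket τ.quotAnchor ∧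
      BigTangent.IsLieAlgebroid I τ.imageSections
        (τ.imageBracket hτ) τ.imageAnchor ∧
      BigTangent.IsLieAlgebroidIso I τ.quotSections τ.inducedBracket τ.quotAnchor
        τ.imageSections (τ.imageBracket hτ) τ.imageAnchor
        τ.tauPrime) ∧
    -- second part
    (∀ hτ : τ.IsWeaklyIntegrable,
      τ.IsIntegrable ↔
        τ.inducedBracket = τ.quotBracket hτ) := by
  refine ⟨fun hτ ↦ τ.inducedBracket_mkQuot hτ, fun h ↦ ?_, fun hτ ↦ τ.isIntegrable_iff hτ⟩
  have hτ := h.isWeaklyIntegrable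
  have hE := τ.isLieAlgebroid_image hτ
  have hφ := τ.isLieAlgebroidIso_tauPrime hτ
  refine ⟨hτ, ?_⟩
  rw [(τ.isIntegrable_iff hτ).1 h]
  exact ⟨hφ.isLieAlgebroid hE, hE, hφ⟩
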